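/- Let $n\ge 1$, $p\in(0,1)$, $\sigma>0$. Client $i\in[n]$ receives a query $x_i\in\mathbb R^l$ and holds a local model $f_i:\mathbb R^l\to\mathbb R^k$, obtained by one of three fusion methods (the same for all clients) from class scores $r_i(x)\in\mathbb R^k$ that are nonnegative with sum $1$: $f_i(x)$ is the mean-centered version ($u\mapsto u-\bar u\mathbf 1$, with $\bar u$ the mean of the entries of $u$) of (a) $r_i(x)$; or (b) $w_i\odot r_i(x)$, where $w_i$ is a fixed nonnegative weight vector with sum $1$; or (c) the one-hot vector of a class with maximal score in $r_i(x)$. Algorithm 1 (over-the-air private collaborative inference). Let $S\subseteq[n]$ contain each client independently with probability $p$, conditioned on $S\neq\emptyset$. Given $S$, each $i\in S$ forms $g_i=f_i(x_i)+m_i$ with independent noises $m_i\sim\mathcal N(0,\tfrac{\sigma^2}{|S|}I_k)$ and transmits $\gamma A g_i/(|S|h_i)$, where $A\in\mathbb R^{d\times k}$ is a fixed projection matrix, $h_i\ne0$ is the channel gain of client $i$, and $\gamma=|S|\,c$ with a constant $c\in\mathbb R$ that does not depend on $S$. The server receives $$z=\sum_{i\in S}h_i\,\frac{\gamma A g_i}{|S|h_i}+w=c\,A\sum_{i\in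 S}g_i+w,$$ where $w\sim\mathcal N(0,vI_d)$, $v\ge0$, is independent channel noise ($v=0$ means that there is none). Two families of local models are neighbouring if they differ in exactly one client's model. The algorithm is $(\varepsilon',\delta')$-DP (with $\varepsilon'>0$ and $\delta'\in[0,1)$) if $\Pr(z\in R)\le e^{\varepsilon'}\Pr(z'\in R)+\delta'$ for all neighbouring families, all queries and all measurable $R\subseteq\mathbb R^d$, where $z$ and $z'$ are the signals received under the two families. Theorem. For every $\varepsilon'>0$, Algorithm 1 is $(\varepsilon',\delta')$-DP, where $$\delta'=\frac{p}{1-(1-p)^n}\left(\Phi\Big(\frac{1}{\sqrt2\,\sigma}-\frac{\varepsilon\sigma}{\sqrt2}\Big)-e^{\varepsilon}\,\Phi\Big(-\frac{1}{\sqrt2\,\sigma}-\frac{\varepsilon\sigma}{\sqrt2}\Big)\right),\qquad \varepsilon=\log\Big(1+\frac{1-(1-p)^n}{p}\,(e^{\varepsilon'}-1)\Big),$$ and $\Phi$ is the standard normal distribution function. -/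

import Mathlib

open MeasureTheory ProbabilityTheory

noncomputable section

/-- The three ways in which a client turns its class scores into the vector it contributes. -/
inductive FusionMethod where
  | beliefAveraging
  | weightedBeliefAveraging
  | majorityVoting

/-- Mean centering: subtract from every entry the average of all the entries. -/
def meanCenter {k : ℕ} (v : Fin k → ℝ) : Fin k → ℝ :=
  fun j => v j - (∑ i, v i) / k

/-- `f : ℝ^l → ℝ^k` is a possible local model for the given fusion method. The class scores `r x`
are nonnegative and sum to one; the per-class weights `w` are nonnegative and sum to one; `c x` is a
class with the largest score (ties may be broken in any way). -/
def IsLocalModel {l k : ℕ} : FusionMethod → ((Fin l → ℝ) → (Fin k → ℝ)) → Prop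
  | .beliefAveraging, f =>
      ∃ r : (Fin l → ℝ) → (Fin k → ℝ), (∀ x, r x ∈ stdSimplex ℝ (Fin k)) ∧
        ∀ x, f x = meanCenter (r x)
  | .weightedBeliefAveraging, f =>
      ∃ r : (Fin l → ℝ) → (Fin k → ℝ), (∀ x, r x ∈ stdSimplex ℝ (Fin k)) ∧
        ∃ w ∈ stdSimplex ℝ (Fin k), ∀ x, f x = meanCenter (fun j => w j * r x j)
  | .majorityVoting, f =>
      ∃ r : (Fin l → ℝ) → (Fin k → ℝ), (∀ x, r x ∈ stdSimplex ℝ (Fin k)) ∧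
        ∃ c : (Fin l → ℝ) → Fin k, (∀ x j, r x j ≤ r x (c x)) ∧
          ∀ x, f x = meanCenter (Pi.single (c x) 1)

/-- All possible families of local models of the `n` clients. -/
def modelFamilies (n l k : ℕ) (method : FusionMethod) :
    Set (Fin n → (Fin l → ℝ) → (Fin k → ℝ)) :=
  {L | ∀ i, IsLocalModel method (L i)}

/-- Two families of local models are neighbouring if they differ in exactly one client. -/
def Neighbouring {n l k : ℕ} (L L' : Fin n → (Fin l → ℝ) → (Fin k → ℝ)) : Prop :=
  ∃ j, L j ≠ L' j ∧ ∀ i, i ≠ j → L i = L' i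

/-- `(ε, δ)`-differential privacy of a randomized map `M`, given as the law `M X L` of its output on
the queries `X` (client `i` receives `X i`) and the local models `L`, with respect to the
replacement of one local model. -/
def IsDP {n l k d : ℕ} (models : Set (Fin n → (Fin l → ℝ) → (Fin k → ℝ)))
    (M : (Fin n → Fin l → ℝ) → (Fin n → (Fin l → ℝ) → (Fin k → ℝ)) → Measure (Fin d → ℝ))
    (ε δ : ℝ) : Prop :=
  0 < ε ∧ 0 ≤ δ ∧ δ < 1 ∧
    ∀ L ∈ models, ∀ L' ∈ models, Neighbouring L L' →
      ∀ (X : Fin n → Fin l → ℝ) (R : Set (Fin d → ℝ)), MeasurableSet R →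
        M X L R ≤ ENNReal.ofReal (Real.exp ε) * M X L' R + ENNReal.ofReal δ

/-- The isotropic Gaussian law `N(0, v I_m)` on `ℝ^m`. -/
def isotropicGaussian (m : ℕ) (v : ℝ) : Measure (Fin m → ℝ) :=
  Measure.pi fun _ => gaussianReal 0 v.toNNReal

/-- The law of the set of participating clients: every client participates independently with
probability `p`, conditioned on at least one client participating. -/
def participationLaw (n : ℕ) (p : unitInterval) : Measure (Set (Fin n)) :=
  ProbabilityTheory.cond (setBernoulli Set.univ p) {S | S.Nonempty}

/-- The common scaling factor `γ` used when `S` is the set of participating clients. -/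
def scalingFactor {n : ℕ} (c : ℝ) (S : Set (Fin n)) : ℝ := S.ncard * c

open scoped Classical in
/-- The signal transmitted by client `i`, whose noisy prediction is `g`: the vector
`γ A g / (|S| h_i)` if the client participates, and zero otherwise. -/
def transmittedSignal {n k d : ℕ} (c : ℝ) (A : Matrix (Fin d) (Fin k) ℝ) (h : Fin n → ℝ)
    (S : Set (Fin n)) (i : Fin n) (g : Fin k → ℝ) : Fin d → ℝ :=
  if i ∈ S then (scalingFactor c S / (S.ncard * h i)) • A.mulVec g else 0

/-- The signal received over the multiple access channel when the participating set is `S`, the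
client noises are `m` and the channel noise is `w`. -/
def receivedSignal {n l k d : ℕ} (c : ℝ) (A : Matrix (Fin d) (Fin k) ℝ) (h : Fin n → ℝ)
    (X : Fin n → Fin l → ℝ) (L : Fin n → (Fin l → ℝ) → (Fin k → ℝ)) (S : Set (Fin n))
    (m : Fin n → Fin k → ℝ) (w : Fin d → ℝ) : Fin d → ℝ :=
  ∑ i, h i • transmittedSignal c A h S i (L i (X i) + m i) + w

/-- The law of the received signal given the participating set `S`: the client noises are
independent `N(0, (σ²/|S|) I_k)`, and the independent channel noise is `N(0, v I_d)`. -/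
def signalLawGiven {n l k d : ℕ} (σ c : ℝ) (v : NNReal) (A : Matrix (Fin d) (Fin k) ℝ)
    (h : Fin n → ℝ) (X : Fin n → Fin l → ℝ) (L : Fin n → (Fin l → ℝ) → (Fin k → ℝ))
    (S : Set (Fin n)) : Measure (Fin d → ℝ) :=
  ((Measure.pi fun _ : Fin n => isotropicGaussian k (σ ^ 2 / S.ncard)).prod
      (isotropicGaussian d v)).map
    fun ω => receivedSignal c A h X L S ω.1 ω.2

/-- The law of the signal received by the server in private collaborative inference over the air,
with random participation of the clients. -/
def collaborativeInference {n l k d : ℕ} (p : unitInterval) (σ c : ℝ) (v : NNReal)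
    (A : Matrix (Fin d) (Fin k) ℝ) (h : Fin n → ℝ)
    (X : Fin n → Fin l → ℝ) (L : Fin n → (Fin l → ℝ) → (Fin k → ℝ)) : Measure (Fin d → ℝ) :=
  (participationLaw n p).bind (signalLawGiven σ c v A h X L)

/-- The cumulative distribution function `Φ` of the standard normal distribution. -/
def stdNormalCDF (x : ℝ) : ℝ := cdf (gaussianReal 0 1) x

/-- The expression
`δ(ε) = Φ(1/(√2 σ) - εσ/√2) - e^ε Φ(-1/(√2 σ) - εσ/√2)`. -/
def fullParticipationDelta (σ ε : ℝ) : ℝ :=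
  stdNormalCDF (1 / (√2 * σ) - ε * σ / √2) -
    Real.exp ε * stdNormalCDF (-1 / (√2 * σ) - ε * σ / √2)

end

/-! Given a nonempty `S`, the channel gains cancel and the client noises add up to `N(0, σ² I_k)`
whatever `S` is (`signalLawGiven_coe_finset`). The signal is thus a Gaussian mechanism centred at
the sum of the predictions in `S`, followed by a projection and independent noise. Every prediction
has norm at most `√2`, and so has the difference of any two (`sum_sq_meanCenter_sub_le`). Hence
replacing client `j`, removing it, or exchanging it for another client each costs at most `(ε, δ)`
with `δ = fullParticipationDelta σ ε` (`noisyProjectionLaw_apply_le`).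

Amplification splits on whether `j` participates. If it does, the other participants form an
unconditioned Bernoulli set `T`; if not, they form such a set conditioned to be nonempty. A coupling
(`one_sub_mul_sum_powerset_le`) makes the second set either `T` or `T` with one client `i` added, so
`T ∪ {j}` is compared with it by removing `j` or by exchanging `j` for `i`. The event under
participation of `j` is then bounded both by its counterpart in the other family and by the event
without `j`. A convex combination of the two bounds (`amplification_le`) gives `ε'` and the factor
`p / (1 - (1 - p)^n)`. -/

/-! ### One-dimensional Gaussian trade-off. -/

theorem gaussianReal_real_Ici {σ : ℝ} (hσ : 0 < σ) (m t : ℝ) :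
    (gaussianReal m (σ ^ 2).toNNReal).real (Set.Ici t) = stdNormalCDF ((m - t) / σ) := by
  -- The decreasing map `m - σ x` turns the upper half-line into a lower one, so symmetry of `Φ` is
  -- not needed.
  have h : gaussianReal m (σ ^ 2).toNNReal = (gaussianReal 0 1).map (fun x => m + (-σ) * x) := by
    have := Measure.map_map (μ := gaussianReal 0 1) (g := fun x => m + x) (f := fun x => (-σ) * x)
      (by fun_prop) (by fun_prop)
    rw [gaussianReal_map_const_mul, gaussianReal_map_const_add] at this
    refine Eq.trans ?_ this
    congr 1
    · simp
    · ext; simp [sq_nonneg]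
  rw [h, map_measureReal_apply (by fun_prop) measurableSet_Ici, stdNormalCDF, cdf_eq_real]
  congr 1
  ext x
  simp only [Set.mem_preimage, Set.mem_Ici, Set.mem_Iic, le_div_iff₀ hσ]
  constructor <;> intro h <;> linarith

theorem gaussianReal_real_eq_setIntegral (m : ℝ) {v : NNReal} (hv : v ≠ 0) (B : Set ℝ) :
    (gaussianReal m v).real B = ∫ x in B, gaussianPDFReal m v x := by
  rw [measureReal_def, gaussianReal_apply_eq_integral m hv, ENNReal.toReal_ofReal]
  exact integral_nonneg fun x => gaussianPDFReal_nonneg m v x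

theorem exp_mul_gaussianPDFReal_le_iff {σ : ℝ} (hσ : 0 < σ) (ε x : ℝ) :
    0 ≤ gaussianPDFReal √2 (σ ^ 2).toNNReal x -
        Real.exp ε * gaussianPDFReal 0 (σ ^ 2).toNNReal x ↔
      (ε * σ ^ 2 + 1) / √2 ≤ x := by
  have h2 : √2 * √2 = 2 := Real.mul_self_sqrt (by norm_num)
  have h20 : 0 < √2 := by positivity
  have hs : 0 < 2 * σ ^ 2 := by positivity
  have hc : (0 : ℝ) < (√(2 * Real.pi * σ ^ 2))⁻¹ := by positivity
  rw [gaussianPDFReal, gaussianPDFReal, Real.coe_toNNReal _ (sq_nonneg σ), sub_nonneg,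
    mul_left_comm, mul_le_mul_iff_right₀ hc, ← Real.exp_add, Real.exp_le_exp, div_le_iff₀ h20,
    ← sub_nonneg, ← sub_nonneg (b := ε * σ ^ 2 + 1)]
  have : -(x - √2) ^ 2 / (2 * σ ^ 2) - (ε + -(x - 0) ^ 2 / (2 * σ ^ 2))
      = (x * √2 - (ε * σ ^ 2 + 1)) / σ ^ 2 := by
    field_simp
    linear_combination (-1 : ℝ) * h2
  rw [this]
  constructor
  · intro h
    have := mul_nonneg h (sq_nonneg σ)
    rwa [div_mul_cancel₀ _ (by positivity)] at this
  · intro h; positivity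

/-- The optimal trade-off between two one-dimensional Gaussian laws at distance `√2`. -/
theorem gaussianReal_real_le_exp_mul_add {σ : ℝ} (hσ : 0 < σ) (ε : ℝ) {B : Set ℝ}
    (hB : MeasurableSet B) :
    (gaussianReal √2 (σ ^ 2).toNNReal).real B ≤
      Real.exp ε * (gaussianReal 0 (σ ^ 2).toNNReal).real B + fullParticipationDelta σ ε := by
  have hv : (σ ^ 2).toNNReal ≠ 0 := by simpa using hσ.ne'
  set v := (σ ^ 2).toNNReal with hvdef
  have h2 : √2 * √2 = 2 := Real.mul_self_sqrt (by norm_num)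
  have h20 : 0 < √2 := by positivity
  have i1 := integrable_gaussianPDFReal √2 v
  have i0 := (integrable_gaussianPDFReal 0 v).const_mul (Real.exp ε)
  have key (C : Set ℝ) : ∫ x in C, (gaussianPDFReal √2 v x - Real.exp ε * gaussianPDFReal 0 v x) =
      (gaussianReal √2 v).real C - Real.exp ε * (gaussianReal 0 v).real C := by
    rw [integral_sub i1.integrableOn i0.integrableOn, integral_const_mul,
      gaussianReal_real_eq_setIntegral _ hv, gaussianReal_real_eq_setIntegral _ hv]
  -- Neyman–Pearson: the worst event is where the signed density is nonnegative, a half-line because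
  -- the likelihood ratio is monotone.
  have hE : {x | 0 ≤ gaussianPDFReal √2 v x - Real.exp ε * gaussianPDFReal 0 v x} =
      Set.Ici ((ε * σ ^ 2 + 1) / √2) := by
    ext x
    exact exp_mul_gaussianPDFReal_le_iff hσ ε x
  have hle : (gaussianReal √2 v).real B - Real.exp ε * (gaussianReal 0 v).real B ≤
      (gaussianReal √2 v).real (Set.Ici ((ε * σ ^ 2 + 1) / √2)) -
        Real.exp ε * (gaussianReal 0 v).real (Set.Ici ((ε * σ ^ 2 + 1) / √2)) := by
    rw [← key, ← key, ← hE]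
    have hm : StronglyMeasurable
        fun x => gaussianPDFReal √2 v x - Real.exp ε * gaussianPDFReal 0 v x :=
      (stronglyMeasurable_gaussianPDFReal _ _).sub
        ((stronglyMeasurable_gaussianPDFReal _ _).const_mul _)
    exact setIntegral_le_nonneg hB hm (i1.sub i0)
  rw [gaussianReal_real_Ici hσ, gaussianReal_real_Ici hσ] at hle
  have e1 : (√2 - (ε * σ ^ 2 + 1) / √2) / σ = 1 / (√2 * σ) - ε * σ / √2 := by
    field_simp
    linear_combination h2
  have e0 : (0 - (ε * σ ^ 2 + 1) / √2) / σ = -1 / (√2 * σ) - ε * σ / √2 := by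
    field_simp
    ring
  rw [e1, e0] at hle
  rw [fullParticipationDelta]
  linarith

theorem fullParticipationDelta_nonneg {σ : ℝ} (hσ : 0 < σ) (ε : ℝ) :
    0 ≤ fullParticipationDelta σ ε := by
  simpa using gaussianReal_real_le_exp_mul_add hσ ε MeasurableSet.empty

theorem stdNormalCDF_pos (x : ℝ) : 0 < stdNormalCDF x := by
  rw [stdNormalCDF, cdf_eq_real, measureReal_def]
  refine ENNReal.toReal_pos (fun h => ?_) (measure_ne_top _ _)
  have := gaussianReal_absolutelyContinuous' 0 (v := 1) one_ne_zero h
  simp at this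

theorem fullParticipationDelta_lt_one (σ ε : ℝ) : fullParticipationDelta σ ε < 1 := by
  have h1 : stdNormalCDF (1 / (√2 * σ) - ε * σ / √2) ≤ 1 := cdf_le_one _ _
  have h2 := mul_pos (Real.exp_pos ε) (stdNormalCDF_pos (-1 / (√2 * σ) - ε * σ / √2))
  rw [fullParticipationDelta]
  linarith

/-! ### Isotropic Gaussian vectors: summation and splitting. -/

instance (m : ℕ) (v : ℝ) : IsProbabilityMeasure (isotropicGaussian m v) := by
  unfold isotropicGaussian
  infer_instance

theorem charFunDual_gaussianReal (v : NNReal) (L : StrongDual ℝ ℝ) :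
    charFunDual (gaussianReal 0 v) L = Complex.exp (-((v / 2 * L 1 ^ 2 : ℝ) : ℂ)) := by
  rw [charFunDual_eq_charFun_map_one, gaussianReal_map_continuousLinearMap, charFun_gaussianReal]
  congr 1
  simp [max_eq_left (sq_nonneg (L 1))]
  ring

theorem charFunDual_isotropicGaussian (k : ℕ) {v : ℝ} (hv : 0 ≤ v) (L : StrongDual ℝ (Fin k → ℝ)) :
    charFunDual (isotropicGaussian k v) L =
      Complex.exp (-((v / 2 * ∑ i, L (Pi.single i 1) ^ 2 : ℝ) : ℂ)) := by
  rw [isotropicGaussian, charFunDual_pi]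
  simp_rw [charFunDual_gaussianReal]
  rw [← Complex.exp_sum, Real.coe_toNNReal v hv]
  congr 1
  simp [Finset.mul_sum]

/-- Over any nonempty set of participants, the client noises add up to a noise whose law does not
depend on that set. -/
theorem map_sum_pi_isotropicGaussian (n k : ℕ) (s : ℝ) {S : Finset (Fin n)} (hS : S.Nonempty) :
    (Measure.pi fun _ : Fin n => isotropicGaussian k (s ^ 2 / S.card)).map
      (fun m => ∑ i ∈ S, m i) = isotropicGaussian k (s ^ 2) := by
  have hc : (S.card : ℝ) ≠ 0 := by exact_mod_cast hS.card_pos.ne'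
  let T : (Fin n → Fin k → ℝ) →L[ℝ] (Fin k → ℝ) :=
    ∑ i ∈ S, ContinuousLinearMap.proj (R := ℝ) (φ := fun _ : Fin n => Fin k → ℝ) i
  have hT : (fun m : Fin n → Fin k → ℝ => ∑ i ∈ S, m i) = T := by
    ext m
    simp [T]
  rw [hT]
  have : IsProbabilityMeasure ((Measure.pi fun _ : Fin n =>
      isotropicGaussian k (s ^ 2 / S.card)).map T) :=
    Measure.isProbabilityMeasure_map (by fun_prop)
  refine Measure.ext_of_charFunDual (funext fun L => ?_)
  rw [charFunDual_map, charFunDual_pi, charFunDual_isotropicGaussian _ (by positivity)]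
  simp_rw [charFunDual_isotropicGaussian k (v := s ^ 2 / S.card) (by positivity)]
  rw [← Complex.exp_sum, ← Complex.ofReal_neg]
  congr 1
  simp_rw [← Complex.ofReal_neg]
  rw [← Complex.ofReal_sum, Finset.sum_neg_distrib, ← Finset.mul_sum]
  congr 2
  have (i : Fin n) (j : Fin k) : ((L.comp T).comp
      (ContinuousLinearMap.single ℝ (fun _ : Fin n => Fin k → ℝ) i)) (Pi.single j 1) =
      if i ∈ S then L (Pi.single j 1) else 0 := by
    have : T (Pi.single i (Pi.single j 1)) = if i ∈ S then Pi.single j 1 else 0 := by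
      ext a
      simp only [T, sum_apply, ContinuousLinearMap.proj_apply,
        Finset.sum_apply]
      split_ifs with h
      · rw [Finset.sum_eq_single i] <;> simp_all
      · refine Finset.sum_eq_zero fun b hb => ?_
        have : b ≠ i := fun e => h (e ▸ hb)
        simp [this]
    simp only [ContinuousLinearMap.comp_apply, ContinuousLinearMap.single_apply, this]
    split_ifs <;> simp
  simp_rw [this]
  rw [Finset.sum_comm]
  simp only [ite_pow, ne_eq, OfNat.ofNat_ne_zero, not_false_eq_true, zero_pow,
    Finset.sum_ite_mem, Finset.univ_inter, Finset.sum_const, nsmul_eq_mul, ← Finset.mul_sum]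
  field_simp

/-- An isotropic Gaussian vector splits into a one-dimensional Gaussian component along a vector
`a` of norm at most one and an independent remainder. -/
theorem map_isotropicGaussian_prod_gaussianReal {k : ℕ} (s : ℝ) (a : Fin k → ℝ)
    (ha : ∑ i, a i ^ 2 ≤ 1) :
    ∃ B : (Fin k → ℝ) →L[ℝ] (Fin k → ℝ),
      ((isotropicGaussian k (s ^ 2)).prod (gaussianReal 0 (s ^ 2).toNNReal)).map
        (fun x => B x.1 + x.2 • a) = isotropicGaussian k (s ^ 2) := by
  set q := ∑ i, a i ^ 2 with hq
  set r := √(1 - q) with hr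
  have hr0 : 0 ≤ r := Real.sqrt_nonneg _
  have hr2 : r ^ 2 = 1 - q := Real.sq_sqrt (by linarith)
  -- With `B = I - β a aᵀ`, the covariance identity `B Bᵀ + a aᵀ = I` follows from `β² q - 2β + 1 =
  -- 0`. This form of the root also covers `a = 0`.
  set β := (1 + r)⁻¹ with hβ
  have hβr : β * (1 + r) = 1 := inv_mul_cancel₀ (by positivity)
  let φ : StrongDual ℝ (Fin k → ℝ) := ∑ i, a i • ContinuousLinearMap.proj (R := ℝ) i
  let B : (Fin k → ℝ) →L[ℝ] (Fin k → ℝ) :=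
    ContinuousLinearMap.id ℝ _ - (β • φ).smulRight a
  let T : (Fin k → ℝ) × ℝ →L[ℝ] (Fin k → ℝ) :=
    B.comp (.fst ℝ _ _) + (ContinuousLinearMap.snd ℝ _ _).smulRight a
  refine ⟨B, ?_⟩
  have hT : (fun x : (Fin k → ℝ) × ℝ => B x.1 + x.2 • a) = T := by
    ext x
    simp [T]
  rw [hT]
  have : IsProbabilityMeasure (((isotropicGaussian k (s ^ 2)).prod
      (gaussianReal 0 (s ^ 2).toNNReal)).map T) :=
    Measure.isProbabilityMeasure_map (by fun_prop)
  refine Measure.ext_of_charFunDual (funext fun L => ?_)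
  rw [charFunDual_map, charFunDual_prod, charFunDual_isotropicGaussian _ (by positivity),
    charFunDual_isotropicGaussian _ (by positivity), charFunDual_gaussianReal,
    Real.coe_toNNReal _ (sq_nonneg s), ← Complex.exp_add]
  congr 1
  have h1 (i : Fin k) : (L.comp T).comp (.inl ℝ _ _) (Pi.single i 1) =
      L (Pi.single i 1) - β * a i * L a := by
    have hφ : φ (Pi.single i 1) = a i := by
      simp [φ, Pi.single_apply]
    simp [T, B, hφ]
  have h2 : (L.comp T).comp (.inr ℝ _ _) 1 = L a := by simp [T]
  have hLa : L a = ∑ i, a i * L (Pi.single i 1) := by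
    conv_lhs => rw [← Finset.univ_sum_single a]
    rw [map_sum]
    refine Finset.sum_congr rfl fun i _ => ?_
    rw [← smul_eq_mul, ← map_smul, ← Pi.single_smul, smul_eq_mul, mul_one]
  have h3 : ∑ i, (L (Pi.single i 1) - β * a i * L a) ^ 2 =
      ∑ i, L (Pi.single i 1) ^ 2 - L a ^ 2 := by
    have : ∀ i, (L (Pi.single i 1) - β * a i * L a) ^ 2 = L (Pi.single i 1) ^ 2
        - 2 * β * L a * (a i * L (Pi.single i 1)) + β ^ 2 * L a ^ 2 * a i ^ 2 := fun i => by ring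
    simp_rw [this]
    rw [Finset.sum_add_distrib, Finset.sum_sub_distrib, ← Finset.mul_sum, ← Finset.mul_sum, ← hLa,
      ← hq]
    have : q = 1 - r ^ 2 := by linarith
    rw [this]
    linear_combination (L a ^ 2 * (β * (1 - r) - 1)) * hβr
  simp_rw [h1]
  rw [h2, h3]
  push_cast
  ring

/-! ### The mechanism for a fixed participating set. -/

/-- Post-processing with shared independent randomness: the bound holds on each fibre and integrates
against the probability measure `κ`. -/
theorem map_prod_apply_le {E F : Type*} [MeasurableSpace E] [MeasurableSpace F] {κ : Measure E}
    [IsProbabilityMeasure κ] {N₁ N₀ : Measure ℝ} [SFinite N₁] [SFinite N₀] {C D : ENNReal}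
    (hN : ∀ B, MeasurableSet B → N₁ B ≤ C * N₀ B + D) {f : E × ℝ → F} (hf : Measurable f)
    {R : Set F} (hR : MeasurableSet R) :
    (κ.prod N₁).map f R ≤ C * (κ.prod N₀).map f R + D := by
  rw [Measure.map_apply hf hR, Measure.map_apply hf hR, Measure.prod_apply (hf hR),
    Measure.prod_apply (hf hR)]
  calc ∫⁻ x, N₁ (Prod.mk x ⁻¹' (f ⁻¹' R)) ∂κ
      ≤ ∫⁻ x, (C * N₀ (Prod.mk x ⁻¹' (f ⁻¹' R)) + D) ∂κ :=
        lintegral_mono fun x => hN _ (measurable_prodMk_left (hf hR))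
    _ = _ := by
        rw [lintegral_add_right _ measurable_const, lintegral_const_mul _
          (measurable_measure_prodMk_left (hf hR)), lintegral_const, measure_univ, mul_one]

/-- The law of `c A (μ + ξ) + w`, where `ξ` is an `N(0, s² I_k)` noise and `w` is an independent
`N(0, v I_d)` noise. -/
noncomputable def noisyProjectionLaw {k d : ℕ} (s c : ℝ) (v : NNReal) (A : Matrix (Fin d) (Fin k) ℝ)
    (μ : Fin k → ℝ) : Measure (Fin d → ℝ) :=
  ((isotropicGaussian d v).prod (isotropicGaussian k (s ^ 2))).map
    fun ω => c • A.mulVec (μ + ω.2) + ω.1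

section

variable {k d : ℕ} (s c : ℝ) (v : NNReal) (A : Matrix (Fin d) (Fin k) ℝ)

theorem continuous_noisyProjection (μ : Fin k → ℝ) :
    Continuous fun ω : (Fin d → ℝ) × (Fin k → ℝ) => c • A.mulVec (μ + ω.2) + ω.1 := by
  have : Continuous fun x : Fin k → ℝ => A.mulVec x := Continuous.matrix_mulVec continuous_const
    continuous_id
  fun_prop

instance (μ : Fin k → ℝ) : IsProbabilityMeasure (noisyProjectionLaw s c v A μ) :=
  Measure.isProbabilityMeasure_map (continuous_noisyProjection c A μ).measurable.aemeasurable

theorem receivedSignal_coe_finset {n l : ℕ} {h : Fin n → ℝ} (hh : ∀ i, h i ≠ 0)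
    (X : Fin n → Fin l → ℝ) (L : Fin n → (Fin l → ℝ) → (Fin k → ℝ)) {S : Finset (Fin n)}
    (hS : S.Nonempty) (m : Fin n → Fin k → ℝ) (w : Fin d → ℝ) :
    receivedSignal c A h X L S m w =
      c • A.mulVec (∑ i ∈ S, L i (X i) + ∑ i ∈ S, m i) + w := by
  have hc : (S.card : ℝ) ≠ 0 := by exact_mod_cast hS.card_pos.ne'
  have (i : Fin n) : h i • transmittedSignal c A h S i (L i (X i) + m i) =
      if i ∈ S then c • A.mulVec (L i (X i) + m i) else 0 := by
    simp only [transmittedSignal, scalingFactor, Finset.mem_coe, Set.ncard_coe_finset]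
    split_ifs
    · rw [smul_smul]
      congr 1
      have := hh i
      field_simp
    · simp
  simp only [receivedSignal, this]
  rw [Finset.sum_ite_mem, Finset.univ_inter, ← Finset.smul_sum, ← Finset.sum_add_distrib]
  congr 2
  exact (map_sum (Matrix.mulVecLin A) _ _).symm

theorem signalLawGiven_coe_finset {n l : ℕ} {h : Fin n → ℝ} (hh : ∀ i, h i ≠ 0)
    (X : Fin n → Fin l → ℝ) (L : Fin n → (Fin l → ℝ) → (Fin k → ℝ)) {S : Finset (Fin n)}
    (hS : S.Nonempty) :
    signalLawGiven s c v A h X L S = noisyProjectionLaw s c v A (∑ i ∈ S, L i (X i)) := by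
  have hm : Measurable fun m : Fin n → Fin k → ℝ => ∑ i ∈ S, m i := by fun_prop
  have e : (isotropicGaussian d v).prod (isotropicGaussian k (s ^ 2)) =
      ((Measure.pi fun _ : Fin n => isotropicGaussian k (s ^ 2 / S.card)).prod
        (isotropicGaussian d v)).map (fun ω => (ω.2, ∑ i ∈ S, ω.1 i)) := by
    have h1 := Measure.map_prod_map (isotropicGaussian d v)
      (Measure.pi fun _ : Fin n => isotropicGaussian k (s ^ 2 / S.card)) measurable_id hm
    rw [Measure.map_id, map_sum_pi_isotropicGaussian n k s hS] at h1
    rw [h1, ← Measure.prod_swap, Measure.map_map (by fun_prop) measurable_swap]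
    rfl
  rw [signalLawGiven, noisyProjectionLaw, e,
    Measure.map_map (continuous_noisyProjection c A _).measurable (by fun_prop)]
  congr 1
  · ext ω : 1
    simp [receivedSignal_coe_finset c A hh X L hS]
  · simp

/-- The Gaussian mechanism followed by a projection and an additive independent noise. -/
theorem noisyProjectionLaw_apply_le {s : ℝ} (hs : 0 < s) (ε : ℝ) {μ μ' : Fin k → ℝ}
    (hμ : ∑ i, (μ i - μ' i) ^ 2 ≤ 2) {R : Set (Fin d → ℝ)} (hR : MeasurableSet R) :
    (noisyProjectionLaw s c v A μ).real R ≤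
      Real.exp ε * (noisyProjectionLaw s c v A μ').real R + fullParticipationDelta s ε := by
  have hδ := fullParticipationDelta_nonneg hs ε
  have h20 : √2 ≠ 0 := by positivity
  -- Along this `a`, moving the centre from `μ'` to `μ` is the same as shifting the scalar component
  -- of the noise by exactly `√2`, even when `μ` and `μ'` are closer than that.
  set a : Fin k → ℝ := (√2)⁻¹ • (μ - μ') with ha
  have ha1 : ∑ i, a i ^ 2 ≤ 1 := by
    have : ∀ i, a i ^ 2 = (μ i - μ' i) ^ 2 / 2 := fun i => by
      simp only [ha, Pi.smul_apply, Pi.sub_apply, smul_eq_mul, mul_pow, inv_pow]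
      rw [Real.sq_sqrt (by norm_num)]
      ring
    simp_rw [this, ← Finset.sum_div]
    linarith
  obtain ⟨B, hB⟩ := map_isotropicGaussian_prod_gaussianReal s a ha1
  let f (x : ((Fin d → ℝ) × (Fin k → ℝ)) × ℝ) : Fin d → ℝ :=
    c • A.mulVec (μ' + (B x.1.2 + x.2 • a)) + x.1.1
  have hg : Measurable fun y : (Fin k → ℝ) × ℝ => B y.1 + y.2 • a := by fun_prop
  have hf : Measurable f :=
    (continuous_noisyProjection c A μ').measurable.comp (g := fun ω => c • A.mulVec (μ' + ω.2) + ω.1)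
      (f := fun x : ((Fin d → ℝ) × (Fin k → ℝ)) × ℝ => (x.1.1, B x.1.2 + x.2 • a)) (by fun_prop)
  have law (ν : Fin k → ℝ) : noisyProjectionLaw s c v A ν =
      (((isotropicGaussian d v).prod (isotropicGaussian k (s ^ 2))).prod
        (gaussianReal 0 (s ^ 2).toNNReal)).map
        fun x => c • A.mulVec (ν + (B x.1.2 + x.2 • a)) + x.1.1 := by
    have h1 := Measure.map_prod_map (isotropicGaussian d v)
      ((isotropicGaussian k (s ^ 2)).prod (gaussianReal 0 (s ^ 2).toNNReal)) measurable_id hg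
    rw [Measure.map_id, hB, ← Measure.prodAssoc_prod,
      Measure.map_map (by fun_prop) (MeasurableEquiv.measurable _)] at h1
    conv_lhs => rw [noisyProjectionLaw, h1, Measure.map_map (continuous_noisyProjection c A ν).measurable
      ((measurable_id.prodMap hg).comp (MeasurableEquiv.measurable _))]
    rfl
  have law₀ : noisyProjectionLaw s c v A μ' =
      (((isotropicGaussian d v).prod (isotropicGaussian k (s ^ 2))).prod
        (gaussianReal 0 (s ^ 2).toNNReal)).map f := law μ'
  have law₁ : noisyProjectionLaw s c v A μ =
      (((isotropicGaussian d v).prod (isotropicGaussian k (s ^ 2))).prod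
        (gaussianReal √2 (s ^ 2).toNNReal)).map f := by
    have hG : gaussianReal √2 (s ^ 2).toNNReal =
        (gaussianReal 0 (s ^ 2).toNNReal).map (√2 + ·) := by
      rw [gaussianReal_map_const_add, zero_add]
    have h0 := Measure.map_prod_map ((isotropicGaussian d v).prod (isotropicGaussian k (s ^ 2)))
      (gaussianReal 0 (s ^ 2).toNNReal) measurable_id (measurable_const_add √2)
    rw [law μ, hG, ← Measure.map_id (μ := (isotropicGaussian d v).prod _), h0,
      Measure.map_map hf (by fun_prop), Measure.map_id]
    congr 1
    ext x : 1
    simp only [f, Function.comp_apply, Prod.map_fst, Prod.map_snd, id_eq, add_smul]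
    have : √2 • a = μ - μ' := by rw [ha, smul_smul, mul_inv_cancel₀ h20, one_smul]
    rw [this]
    congr 3
    abel
  have hN (C : Set ℝ) (hC : MeasurableSet C) : gaussianReal √2 (s ^ 2).toNNReal C ≤
      ENNReal.ofReal (Real.exp ε) * gaussianReal 0 (s ^ 2).toNNReal C +
        ENNReal.ofReal (fullParticipationDelta s ε) := by
    rw [← ofReal_measureReal (μ := gaussianReal √2 _), ← ofReal_measureReal (μ := gaussianReal 0 _),
      ← ENNReal.ofReal_mul (Real.exp_pos ε).le, ← ENNReal.ofReal_add (by positivity) hδ]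
    exact ENNReal.ofReal_le_ofReal (gaussianReal_real_le_exp_mul_add hs ε hC)
  have := map_prod_apply_le (κ := (isotropicGaussian d v).prod (isotropicGaussian k (s ^ 2)))
    hN hf hR
  rw [← law₀, ← law₁, ← ofReal_measureReal (μ := noisyProjectionLaw s c v A μ),
    ← ofReal_measureReal (μ := noisyProjectionLaw s c v A μ'),
    ← ENNReal.ofReal_mul (Real.exp_pos ε).le, ← ENNReal.ofReal_add (by positivity) hδ] at this
  exact (ENNReal.ofReal_le_ofReal_iff (by positivity)).1 this

end

/-! ### Sensitivity of the fused predictions. -/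

/-- Centering is an orthogonal projection, and nonnegative vectors have nonnegative inner product,
so the squared distance is at most the sum of the squared norms. Allowing sums below one covers
weighted scores and the zero vector. -/
theorem sum_sq_meanCenter_sub_le {k : ℕ} {a b : Fin k → ℝ} (ha : ∀ i, 0 ≤ a i) (hb : ∀ i, 0 ≤ b i)
    (ha1 : ∑ i, a i ≤ 1) (hb1 : ∑ i, b i ≤ 1) :
    ∑ i, (meanCenter a i - meanCenter b i) ^ 2 ≤ 2 := by
  have sq_le {a : Fin k → ℝ} (ha : ∀ i, 0 ≤ a i) (ha1 : ∑ i, a i ≤ 1) : ∑ i, a i ^ 2 ≤ 1 :=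
    (Finset.sum_le_sum fun i _ => by
      have : a i ≤ 1 := (Finset.single_le_sum (fun j _ => ha j) (Finset.mem_univ i)).trans ha1
      nlinarith [ha i]).trans ha1
  rcases Nat.eq_zero_or_pos k with rfl | hk
  · simp
  have hk' : (k : ℝ) ≠ 0 := by exact_mod_cast hk.ne'
  set A := ∑ i, a i
  set B := ∑ i, b i
  have h (i : Fin k) : (meanCenter a i - meanCenter b i) ^ 2 =
      (a i - b i) ^ 2 - 2 * ((A - B) / k) * (a i - b i) + ((A - B) / k) ^ 2 := by
    simp only [meanCenter]
    ring
  calc ∑ i, (meanCenter a i - meanCenter b i) ^ 2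
      = ∑ i, (a i - b i) ^ 2 - (A - B) ^ 2 / k := by
        simp_rw [h]
        rw [Finset.sum_add_distrib, Finset.sum_sub_distrib, ← Finset.mul_sum,
          Finset.sum_sub_distrib, Finset.sum_const, Finset.card_univ, Fintype.card_fin,
          nsmul_eq_mul]
        field_simp
        ring
    _ ≤ ∑ i, (a i - b i) ^ 2 := sub_le_self _ (by positivity)
    _ ≤ ∑ i, (a i ^ 2 + b i ^ 2) := Finset.sum_le_sum fun i _ => by nlinarith [ha i, hb i]
    _ ≤ 2 := by
        rw [Finset.sum_add_distrib]
        linarith [sq_le ha ha1, sq_le hb hb1]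

theorem IsLocalModel.exists_eq_meanCenter {l k : ℕ} {method : FusionMethod}
    {f : (Fin l → ℝ) → (Fin k → ℝ)} (hf : IsLocalModel method f) (x : Fin l → ℝ) :
    ∃ a : Fin k → ℝ, (∀ i, 0 ≤ a i) ∧ ∑ i, a i ≤ 1 ∧ f x = meanCenter a := by
  cases method with
  | beliefAveraging =>
    obtain ⟨r, hr, hf⟩ := hf
    exact ⟨r x, (hr x).1, (hr x).2.le, hf x⟩
  | weightedBeliefAveraging =>
    obtain ⟨r, hr, w, hw, hf⟩ := hf
    refine ⟨_, fun i => mul_nonneg (hw.1 i) ((hr x).1 i), ?_, hf x⟩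
    rw [← (hr x).2]
    refine Finset.sum_le_sum fun i _ => mul_le_of_le_one_left ((hr x).1 i) ?_
    exact (Finset.single_le_sum (fun j _ => hw.1 j) (Finset.mem_univ i)).trans hw.2.le
  | majorityVoting =>
    obtain ⟨r, hr, c, hc, hf⟩ := hf
    refine ⟨_, fun i => ?_, ?_, hf x⟩
    · by_cases h : i = c x <;> simp [h]
    · simp

theorem IsLocalModel.sum_sq_sub_le {l k : ℕ} {method : FusionMethod}
    {f g : (Fin l → ℝ) → (Fin k → ℝ)} (hf : IsLocalModel method f) (hg : IsLocalModel method g)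
    (x y : Fin l → ℝ) : ∑ i, (f x i - g y i) ^ 2 ≤ 2 := by
  obtain ⟨a, ha, ha1, hfx⟩ := hf.exists_eq_meanCenter x
  obtain ⟨b, hb, hb1, hgy⟩ := hg.exists_eq_meanCenter y
  rw [hfx, hgy]
  exact sum_sq_meanCenter_sub_le ha hb ha1 hb1

theorem IsLocalModel.sum_sq_le {l k : ℕ} {method : FusionMethod}
    {f : (Fin l → ℝ) → (Fin k → ℝ)} (hf : IsLocalModel method f) (x : Fin l → ℝ) :
    ∑ i, f x i ^ 2 ≤ 2 := by
  obtain ⟨a, ha, ha1, hfx⟩ := hf.exists_eq_meanCenter x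
  have := sum_sq_meanCenter_sub_le ha (b := 0) (fun _ => le_rfl) ha1 (by simp)
  simpa [hfx, meanCenter] using this

/-! ### Coupling a Bernoulli subset with its nonempty conditioning. -/

theorem sum_tail_succ (b : ℕ → ℝ) {m t : ℕ} (ht : t < m) :
    ∑ s ∈ Finset.range (m - t), b (t + s + 1) =
      b (t + 1) + ∑ s ∈ Finset.range (m - (t + 1)), b (t + 1 + s + 1) := by
  obtain ⟨r, rfl⟩ := Nat.exists_eq_add_of_lt ht
  rw [show t + r + 1 - t = r + 1 by omega, show t + r + 1 - (t + 1) = r by omega,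
    Finset.sum_range_succ', add_comm]
  congr 1
  exact Finset.sum_congr rfl fun s _ => by congr 1; omega

/-- If `b` is a probability vector on `{0, …, m}` whose shifted tails are dominated by its tail at
`0`, then `b` is dominated by a monotone coupling, with steps at most one, with `b` conditioned on
being nonzero. -/
theorem one_sub_mul_sum_le_of_tail_le {m : ℕ} {b g H : ℕ → ℝ} (hb : ∀ t, 0 ≤ b t)
    (hb1 : ∑ t ∈ Finset.range (m + 1), b t = 1)
    (hsub : ∀ t s, t + s ≤ m → b 0 * b (t + s) ≤ b t * b s)
    (h0 : ∀ t < m, g (t + 1) ≤ H (t + 1)) (h1 : ∀ t < m, g t ≤ H (t + 1)) :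
    (1 - b 0) * ∑ t ∈ Finset.range (m + 1), b t * g t ≤
      ∑ t ∈ Finset.range m, b (t + 1) * H (t + 1) := by
  set B : ℕ → ℝ := fun t => ∑ s ∈ Finset.range (m - t), b (t + s + 1) with hB
  have hBpos (t) : 0 ≤ B t := Finset.sum_nonneg fun _ _ => hb _
  have hB0 : B 0 = 1 - b 0 := by
    rw [Finset.sum_range_succ'] at hb1
    simp only [hB, Nat.sub_zero, zero_add]
    linarith
  have htail (t) (ht : t < m) : b 0 * B t ≤ b t * B 0 := by
    simp only [hB, Nat.sub_zero, zero_add, Finset.mul_sum]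
    refine (Finset.sum_le_sum fun s hs => ?_).trans
      (Finset.sum_le_sum_of_subset_of_nonneg (Finset.range_mono (Nat.sub_le m t))
        fun _ _ _ => mul_nonneg (hb _) (hb _))
    rw [Finset.mem_range] at hs
    exact hsub t (s + 1) (by omega)
  have hBm : B m = 0 := by simp [hB]
  -- After scaling by `1 - b 0`, the mass `b 0 * B r` is what the coupling must carry from level `r`
  -- to level `r + 1`. By `htail` level `r` alone can supply it, so no mass moves by two steps.
  have key : ∀ r ≤ m, (1 - b 0) * ∑ t ∈ Finset.range (r + 1), b t * g t ≤
      ∑ t ∈ Finset.range r, b (t + 1) * H (t + 1) + b 0 * B r * g r := by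
    intro r
    induction r with
    | zero => simp [hB0]; linarith
    | succ r ih =>
      intro hr
      have ih := ih (by omega)
      rw [Finset.sum_range_succ, Finset.sum_range_succ (fun t => b (t + 1) * H (t + 1)), mul_add]
      have hBr : B r = b (r + 1) + B (r + 1) := sum_tail_succ b (by omega)
      have hc : 0 ≤ b (r + 1) * B 0 - b 0 * B (r + 1) := by
        rcases Nat.lt_or_ge (r + 1) m with h | h
        · linarith [htail (r + 1) h]
        · rw [show r + 1 = m by omega, hBm]
          simpa using mul_nonneg (hb m) (hBpos 0)
      have e1 := mul_le_mul_of_nonneg_left (h0 r (by omega)) hc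
      have e2 := mul_le_mul_of_nonneg_left (h1 r (by omega)) (mul_nonneg (hb 0) (hBpos r))
      rw [hBr] at ih e2
      rw [hB0] at e1
      linarith
  simpa [hBm] using key m le_rfl

theorem choose_add_le (m t s : ℕ) :
    m.choose (t + s) ≤ m.choose t * m.choose s := by
  have := Nat.choose_mul (n := m) (k := t + s) (s := t) (by omega)
  rw [Nat.add_sub_cancel_left] at this
  calc m.choose (t + s) ≤ m.choose (t + s) * (t + s).choose t :=
        Nat.le_mul_of_pos_right _ (Nat.choose_pos (by omega))
    _ = m.choose t * (m - t).choose s := this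
    _ ≤ m.choose t * m.choose s := Nat.mul_le_mul_left _ (Nat.choose_le_choose s (Nat.sub_le m t))

/-- Double counting: each set of size `t + 1` arises from `t + 1` choices of the inserted element.
-/
theorem sum_powersetCard_sum_insert {ι : Type*} [DecidableEq ι] (M : Finset ι) (t : ℕ)
    (H : Finset ι → ℝ) :
    ∑ T ∈ M.powersetCard t, ∑ i ∈ M \ T, H (insert i T) =
      (t + 1) * ∑ U ∈ M.powersetCard (t + 1), H U := by
  have : (t + 1) * ∑ U ∈ M.powersetCard (t + 1), H U =
      ∑ U ∈ M.powersetCard (t + 1), ∑ _i ∈ U, H U := by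
    rw [Finset.mul_sum]
    refine Finset.sum_congr rfl fun U hU => ?_
    rw [Finset.sum_const, (Finset.mem_powersetCard.1 hU).2, nsmul_eq_mul]
    push_cast
    rfl
  rw [this, Finset.sum_sigma', Finset.sum_sigma']
  refine Finset.sum_bij' (fun x _ => ⟨insert x.2 x.1, x.2⟩) (fun x _ => ⟨x.1.erase x.2, x.2⟩)
    ?_ ?_ ?_ ?_ ?_
  · rintro ⟨T, i⟩ h
    simp only [Finset.mem_sigma, Finset.mem_powersetCard, Finset.mem_sdiff] at h ⊢
    exact ⟨⟨Finset.insert_subset h.2.1 h.1.1, by rw [Finset.card_insert_of_notMem h.2.2, h.1.2]⟩,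
      Finset.mem_insert_self _ _⟩
  · rintro ⟨U, i⟩ h
    simp only [Finset.mem_sigma, Finset.mem_powersetCard, Finset.mem_sdiff] at h ⊢
    exact ⟨⟨(Finset.erase_subset _ _).trans h.1.1, by rw [Finset.card_erase_of_mem h.2, h.1.2]; rfl⟩,
      h.1.1 h.2, Finset.notMem_erase _ _⟩
  · rintro ⟨T, i⟩ h
    simp only [Finset.mem_sigma, Finset.mem_sdiff] at h
    simp [Finset.erase_insert h.2.2]
  · rintro ⟨U, i⟩ h
    simp only [Finset.mem_sigma] at h
    simp [Finset.insert_erase h.2]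
  · simp

/-- A random subset of `M`, containing each element independently with probability `p`, can be
coupled with such a subset conditioned on being nonempty in such a way that the latter is either
equal to the former or obtained from it by inserting one element. -/
theorem one_sub_mul_sum_powerset_le {ι : Type*} [DecidableEq ι] (M : Finset ι) {p : ℝ}
    (hp0 : 0 ≤ p) (hp1 : p ≤ 1) {g H : Finset ι → ℝ}
    (h0 : ∀ T ⊆ M, T.Nonempty → g T ≤ H T)
    (h1 : ∀ T ⊆ M, ∀ i ∈ M, i ∉ T → g T ≤ H (insert i T)) :
    (1 - (1 - p) ^ M.card) *
        ∑ T ∈ M.powerset, p ^ T.card * (1 - p) ^ (M.card - T.card) * g T ≤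
      ∑ T ∈ M.powerset with T.Nonempty, p ^ T.card * (1 - p) ^ (M.card - T.card) * H T := by
  set m := M.card with hm
  have hq0 : 0 ≤ 1 - p := by linarith
  let w : ℕ → ℝ := fun t => p ^ t * (1 - p) ^ (m - t)
  have hw (t) : 0 ≤ w t := by positivity
  -- The weights depend only on cardinality, so averaging over each level reduces the claim to the
  -- binomial distribution on `{0, …, m}`.
  let avg (f : Finset ι → ℝ) (t : ℕ) : ℝ := (∑ T ∈ M.powersetCard t, f T) / m.choose t
  have level (f : Finset ι → ℝ) (t : ℕ) (ht : t ≤ m) :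
      ∑ T ∈ M.powersetCard t, w T.card * f T = (m.choose t * w t) * avg f t := by
    have : (m.choose t : ℝ) ≠ 0 := by exact_mod_cast (Nat.choose_pos ht).ne'
    simp only [avg]
    field_simp
    rw [Finset.mul_sum]
    exact Finset.sum_congr rfl fun T hT => by rw [(Finset.mem_powersetCard.1 hT).2]
  have total (f : Finset ι → ℝ) : ∑ T ∈ M.powerset, w T.card * f T =
      ∑ t ∈ Finset.range (m + 1), (m.choose t * w t) * avg f t := by
    rw [Finset.sum_powerset]
    exact Finset.sum_congr rfl fun t ht => level f t (by simpa [Nat.lt_succ_iff] using ht)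
  have key := one_sub_mul_sum_le_of_tail_le (m := m) (b := fun t => m.choose t * w t)
    (g := avg g) (H := avg H) (fun t => by have := hw t; positivity) ?_ ?_ ?_ ?_
  · have e0 : ((m.choose 0 : ℕ) : ℝ) * w 0 = (1 - p) ^ m := by simp [w]
    simp only [e0] at key
    rw [← total] at key
    refine key.trans (le_of_eq ?_)
    rw [Finset.sum_filter]
    have := total fun T => if T.Nonempty then H T else 0
    simp only [mul_ite, mul_zero] at this
    refine Eq.trans ?_ this.symm
    rw [Finset.sum_range_succ']
    have z : avg (fun T => if T.Nonempty then H T else 0) 0 = 0 := by simp [avg]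
    rw [z, mul_zero, add_zero]
    refine Finset.sum_congr rfl fun t _ => ?_
    congr 1
    simp only [avg]
    congr 1
    refine Finset.sum_congr rfl fun T hT => ?_
    rw [if_pos (Finset.card_pos.1 (by rw [(Finset.mem_powersetCard.1 hT).2]; omega))]
  · have := add_pow p (1 - p) m
    rw [add_sub_cancel, one_pow] at this
    rw [this]
    exact Finset.sum_congr rfl fun t _ => by simp only [w]; ring
  · intro t s hts
    have hc : (m.choose (t + s) : ℝ) ≤ m.choose t * m.choose s := by
      exact_mod_cast choose_add_le m t s
    -- The powers of `p` and `1 - p` match exactly; only the binomial coefficients create an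
    -- inequality.
    have hww : w 0 * w (t + s) = w t * w s := by
      obtain ⟨r, hr⟩ := Nat.exists_eq_add_of_le hts
      simp only [w, hr]
      rw [show t + s + r - 0 = t + s + r by omega, show t + s + r - (t + s) = r by omega,
        show t + s + r - t = s + r by omega, show t + s + r - s = t + r by omega]
      ring
    calc ((m.choose 0 : ℕ) : ℝ) * w 0 * (m.choose (t + s) * w (t + s))
        = m.choose (t + s) * (w t * w s) := by rw [← hww]; simp; ring
      _ ≤ m.choose t * m.choose s * (w t * w s) :=
        mul_le_mul_of_nonneg_right hc (mul_nonneg (hw t) (hw s))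
      _ = _ := by ring
  · intro t ht
    refine div_le_div_of_nonneg_right (Finset.sum_le_sum fun T hT => ?_) (by positivity)
    rw [Finset.mem_powersetCard] at hT
    exact h0 T hT.1 (Finset.card_pos.1 (by omega))
  · intro t ht
    -- Adding a uniform new element to a uniform `t`-subset gives a uniform `(t + 1)`-subset.
    have hG : (m - t : ℝ) * ∑ T ∈ M.powersetCard t, g T ≤
        (t + 1) * ∑ U ∈ M.powersetCard (t + 1), H U := by
      rw [← sum_powersetCard_sum_insert, Finset.mul_sum]
      refine Finset.sum_le_sum fun T hT => ?_
      rw [Finset.mem_powersetCard] at hT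
      have hc : ((M \ T).card : ℝ) = m - t := by
        rw [Finset.card_sdiff_of_subset hT.1, Nat.cast_sub (Finset.card_le_card hT.1), hT.2]
      rw [← hc, ← nsmul_eq_mul, ← Finset.sum_const]
      refine Finset.sum_le_sum fun i hi => ?_
      rw [Finset.mem_sdiff] at hi
      exact h1 T hT.1 i hi.1 hi.2
    have hch : (m.choose (t + 1) : ℝ) * (t + 1) = m.choose t * (m - t) := by
      rw [← Nat.cast_sub ht.le]
      exact_mod_cast Nat.choose_succ_right_eq m t
    have c0 : (0 : ℝ) < m.choose t := by exact_mod_cast Nat.choose_pos ht.le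
    have c1 : (0 : ℝ) < m.choose (t + 1) := by exact_mod_cast Nat.choose_pos ht
    simp only [avg]
    rw [div_le_div_iff₀ c0 c1]
    refine le_of_mul_le_mul_right ?_ (by positivity : (0 : ℝ) < t + 1)
    have := mul_le_mul_of_nonneg_left hG c0.le
    calc _ = (∑ T ∈ M.powersetCard t, g T) * (m.choose (t + 1) * (t + 1)) := by ring
      _ = m.choose t * ((m - t) * ∑ T ∈ M.powersetCard t, g T) := by rw [hch]; ring
      _ ≤ _ := this
      _ = _ := by ring

/-! ### Mixture over the participating set, and amplification. -/

theorem one_sub_pow_sub_pos {n : ℕ} (hn : 0 < n) {p : ℝ} (hp0 : 0 < p) (hp1 : p < 1) :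
    0 < 1 - (1 - p) ^ n := by
  have := pow_lt_one₀ (by linarith : 0 ≤ 1 - p) (by linarith) hn.ne'
  linarith

theorem setBernoulli_real_nonempty (n : ℕ) (p : unitInterval) :
    (setBernoulli (Set.univ : Set (Fin n)) p).real {S | S.Nonempty} = 1 - (1 - (p : ℝ)) ^ n := by
  have : {S : Set (Fin n) | S.Nonempty} = {∅}ᶜ := by
    ext S
    simp [Set.nonempty_iff_ne_empty]
  rw [this, probReal_compl_eq_one_sub (MeasurableSet.of_discrete),
    setBernoulli_real_singleton p (Set.empty_subset _) Set.finite_univ]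
  simp [Set.ncard_univ]

theorem collaborativeInference_real_apply {n l k d : ℕ} (hn : 0 < n) (p : unitInterval)
    (hp0 : 0 < (p : ℝ)) (hp1 : (p : ℝ) < 1) (σ c : ℝ) (v : NNReal) (A : Matrix (Fin d) (Fin k) ℝ)
    {h : Fin n → ℝ} (hh : ∀ i, h i ≠ 0) (X : Fin n → Fin l → ℝ)
    (L : Fin n → (Fin l → ℝ) → (Fin k → ℝ)) {R : Set (Fin d → ℝ)} (hR : MeasurableSet R) :
    collaborativeInference p σ c v A h X L R = ENNReal.ofReal
      ((1 - (1 - (p : ℝ)) ^ n)⁻¹ * ∑ S : Finset (Fin n) with S.Nonempty,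
        (p : ℝ) ^ S.card * (1 - (p : ℝ)) ^ (n - S.card) *
          (noisyProjectionLaw σ c v A (∑ i ∈ S, L i (X i))).real R) := by
  have hq : 0 ≤ 1 - (p : ℝ) := by linarith
  have hD := one_sub_pow_sub_pos hn hp0 hp1
  have hw (S : Finset (Fin n)) : participationLaw n p {(S : Set (Fin n))} =
      ENNReal.ofReal (if S.Nonempty then
        (1 - (1 - (p : ℝ)) ^ n)⁻¹ * ((p : ℝ) ^ S.card * (1 - (p : ℝ)) ^ (n - S.card)) else 0) := by
    rw [participationLaw, cond_apply (MeasurableSet.of_discrete),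
      ← ofReal_measureReal (s := {S : Set (Fin n) | S.Nonempty}), setBernoulli_real_nonempty,
      ← ENNReal.ofReal_inv_of_pos hD, ← ofReal_measureReal,
      ← ENNReal.ofReal_mul (inv_nonneg.2 hD.le)]
    congr 1
    split_ifs with hS
    · have : {S : Set (Fin n) | S.Nonempty} ∩ {(S : Set (Fin n))} = {(S : Set (Fin n))} := by
        rw [Set.inter_eq_right, Set.singleton_subset_iff]
        exact hS
      rw [this, setBernoulli_real_singleton p (Set.subset_univ _) Set.finite_univ,
        Set.ncard_sdiff (Set.subset_univ _), Set.ncard_univ, Set.ncard_coe_finset]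
      simp
    · have : {S : Set (Fin n) | S.Nonempty} ∩ {(S : Set (Fin n))} = ∅ := by
        rw [Set.inter_singleton_eq_empty]
        simpa using hS
      simp [this]
  rw [collaborativeInference, Measure.bind_apply hR (Measurable.of_discrete).aemeasurable,
    lintegral_fintype, Finset.mul_sum, Finset.sum_filter,
    ENNReal.ofReal_sum_of_nonneg fun S _ => by split_ifs <;> positivity]
  refine (Fintype.sum_equiv Fintype.finsetEquivSet _ _ fun S => ?_).symm
  rw [Fintype.coe_finsetEquivSet, hw]
  split_ifs with hS
  · rw [signalLawGiven_coe_finset σ c v A hh X L hS, ← ofReal_measureReal (s := R),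
      ← ENNReal.ofReal_mul measureReal_nonneg]
    congr 1
    ring
  · simp

/-- Conditioning on the participation of `j`: nonemptiness restricts the remaining set only when `j`
is absent. -/
theorem sum_nonempty_eq_add {n : ℕ} (j : Fin n) (p : ℝ) (G : Finset (Fin n) → ℝ) :
    ∑ S : Finset (Fin n) with S.Nonempty, p ^ S.card * (1 - p) ^ (n - S.card) * G S =
      (1 - p) * (∑ T ∈ (Finset.univ.erase j).powerset with T.Nonempty,
        p ^ T.card * (1 - p) ^ (n - 1 - T.card) * G T) +
      p * ∑ T ∈ (Finset.univ.erase j).powerset,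
        p ^ T.card * (1 - p) ^ (n - 1 - T.card) * G (insert j T) := by
  have hu : (Finset.univ : Finset (Finset (Fin n))) =
      (insert j (Finset.univ.erase j)).powerset := by
    rw [Finset.insert_erase (Finset.mem_univ j), Finset.powerset_univ]
  have hcard (T) (hT : T ∈ (Finset.univ.erase j).powerset) : T.card ≤ n - 1 := by
    have := Finset.card_le_card (Finset.mem_powerset.1 hT)
    simpa using this
  have hn : 0 < n := Fin.pos j
  rw [Finset.sum_filter, hu, Finset.sum_powerset_insert (Finset.notMem_erase j _),
    Finset.sum_filter, Finset.mul_sum, Finset.mul_sum]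
  congr 1
  · refine Finset.sum_congr rfl fun T hT => ?_
    rw [mul_ite, mul_zero, show n - T.card = n - 1 - T.card + 1 by have := hcard T hT; omega]
    split_ifs
    · ring
    · rfl
  · refine Finset.sum_congr rfl fun T hT => ?_
    have hj : j ∉ T := fun h => Finset.notMem_erase j _ (Finset.mem_powerset.1 hT h)
    rw [if_pos (Finset.insert_nonempty j T), Finset.card_insert_of_notMem hj,
      show n - (T.card + 1) = n - 1 - T.card by omega]
    ring

theorem sum_powerset_weights {ι : Type*} (M : Finset ι) (p : ℝ) :
    ∑ T ∈ M.powerset, p ^ T.card * (1 - p) ^ (M.card - T.card) = 1 := by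
  rw [Finset.sum_pow_mul_eq_add_pow, add_sub_cancel, one_pow]

theorem sum_powerset_nonempty_weights {ι : Type*} (M : Finset ι) (p : ℝ) :
    ∑ T ∈ M.powerset with T.Nonempty, p ^ T.card * (1 - p) ^ (M.card - T.card) =
      1 - (1 - p) ^ M.card := by
  have h1 := sum_powerset_weights M p
  rw [← Finset.sum_filter_add_sum_filter_not M.powerset (fun T => T.Nonempty)] at h1
  have : M.powerset.filter (fun T => ¬ T.Nonempty) = {∅} := by
    ext T
    simp only [Finset.mem_filter, Finset.mem_powerset, Finset.not_nonempty_iff_eq_empty,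
      Finset.mem_singleton]
    exact ⟨fun h => h.2, fun h => ⟨h ▸ Finset.empty_subset _, h⟩⟩
  rw [this, Finset.sum_singleton, Finset.card_empty, pow_zero, one_mul, Nat.sub_zero] at h1
  linarith

/-- Privacy amplification: `B` and `a` are the probabilities of an event when the distinguished
client does not, respectively does, participate. -/
theorem amplification_le {p D e δ B a a' r : ℝ} (hp0 : 0 < p) (hpD : p ≤ D) (he : 1 ≤ e)
    (hr : r = 1 + p / D * (e - 1)) (h1 : a ≤ e * a' + δ)
    (h2 : (D - p) * a ≤ (1 - p) * (e * B) + (D - p) * δ) :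
    (1 - p) * B + p * a ≤ r * ((1 - p) * B + p * a') + p * δ := by
  have hD : 0 < D := by linarith
  have he0 : 0 < e := by linarith
  have hmain : D * a ≤ (e - 1) * (1 - p) * B + (D + p * (e - 1)) * a' + D * δ := by
    -- The multipliers `p + e⁻¹ (D - p)` for `h1` and `1 - e⁻¹` for `h2` make the coefficients of
    -- `a` add up to `D`, and those of `δ` likewise.
    have hα : 0 ≤ 1 - e⁻¹ := sub_nonneg.2 (inv_le_one_of_one_le₀ he)
    have hβ : 0 ≤ p + e⁻¹ * (D - p) := by
      have := inv_nonneg.2 he0.le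
      have : 0 ≤ D - p := by linarith
      positivity
    have e1 := mul_le_mul_of_nonneg_left h1 hβ
    have e2 := mul_le_mul_of_nonneg_left h2 hα
    have hinv : e⁻¹ * e = 1 := inv_mul_cancel₀ he0.ne'
    have i1 : (p + e⁻¹ * (D - p)) * (e * a' + δ) =
        (D + p * (e - 1)) * a' + (p + e⁻¹ * (D - p)) * δ := by
      linear_combination ((D - p) * a') * hinv
    have i2 : (1 - e⁻¹) * ((1 - p) * (e * B) + (D - p) * δ) =
        (e - 1) * (1 - p) * B + (1 - e⁻¹) * (D - p) * δ := by
      linear_combination (-(1 - p) * B) * hinv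
    rw [i1] at e1
    rw [i2] at e2
    linarith
  have := mul_le_mul_of_nonneg_left hmain (div_pos hp0 hD).le
  have h3 : p / D * (D * a) = p * a := by field_simp
  have h4 : p / D * ((e - 1) * (1 - p) * B + (D + p * (e - 1)) * a' + D * δ) =
      (r - 1) * (1 - p) * B + r * p * a' + p * δ := by
    rw [hr]
    field_simp
    ring
  rw [h3, h4] at this
  linarith

theorem theorem2 {n l k d : ℕ} (hn : 0 < n) (method : FusionMethod)
    (p : unitInterval) (hp0 : 0 < (p : ℝ)) (hp1 : (p : ℝ) < 1)
    (σ : ℝ) (hσ : 0 < σ) (c : ℝ) (v : NNReal)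
    (A : Matrix (Fin d) (Fin k) ℝ) (h : Fin n → ℝ) (hh : ∀ i, h i ≠ 0)
    (ε' : ℝ) (hε' : 0 < ε') (ε δ' : ℝ)
    (hε : ε = Real.log (1 + ((1 - (1 - (p : ℝ)) ^ n) / p) * (Real.exp ε' - 1)))
    (hδ' : δ' = (p : ℝ) / (1 - (1 - (p : ℝ)) ^ n) * fullParticipationDelta σ ε) :
    IsDP (modelFamilies n l k method) (collaborativeInference p σ c v A h) ε' δ' := by
  set D := 1 - (1 - (p : ℝ)) ^ n with hDdef
  set δ := fullParticipationDelta σ ε with hδ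
  have hD : 0 < D := one_sub_pow_sub_pos hn hp0 hp1
  have hpow : (1 - (p : ℝ)) ^ n = (1 - p) * (1 - (p : ℝ)) ^ (n - 1) := by
    rw [← pow_succ', Nat.sub_add_cancel hn]
  -- This is the probability that `j` is absent while some other client participates.
  have hDp : D - p = (1 - p) * (1 - (1 - (p : ℝ)) ^ (n - 1)) := by
    rw [hDdef, hpow]
    ring
  have hpD : (p : ℝ) ≤ D := by
    have : (1 - (p : ℝ)) ^ (n - 1) ≤ 1 := pow_le_one₀ (by linarith) (by linarith)
    have := mul_nonneg (by linarith : (0 : ℝ) ≤ 1 - p) (sub_nonneg.2 this)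
    linarith
  have hδ0 : 0 ≤ δ := fullParticipationDelta_nonneg hσ ε
  have hexp' : 1 < Real.exp ε' := Real.one_lt_exp_iff.2 hε'
  have hDe : 0 ≤ D / p * (Real.exp ε' - 1) := mul_nonneg (by positivity) (by linarith)
  have hexp : Real.exp ε = 1 + D / p * (Real.exp ε' - 1) := by
    rw [hε, Real.exp_log (by linarith)]
  -- Here `p / D` is the probability that `j` participates, given that the set is nonempty.
  have hr : Real.exp ε' = 1 + p / D * (Real.exp ε - 1) := by
    rw [hexp]
    field_simp
    ring
  refine ⟨hε', hδ' ▸ by positivity, ?_, ?_⟩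
  · calc δ' = p / D * δ := hδ'
      _ ≤ 1 * δ := mul_le_mul_of_nonneg_right ((div_le_one hD).2 hpD) hδ0
      _ < 1 := by simpa using fullParticipationDelta_lt_one σ ε
  rintro L hL L' hL' ⟨j, -, hj⟩ X R hR
  rw [collaborativeInference_real_apply hn p hp0 hp1 σ c v A hh X L hR,
    collaborativeInference_real_apply hn p hp0 hp1 σ c v A hh X L' hR,
    ← ENNReal.ofReal_mul (Real.exp_pos _).le, ← ENNReal.ofReal_add ?_ (hδ' ▸ by positivity)]
  swap
  · have : (0 : ℝ) ≤ 1 - p := by linarith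
    positivity
  apply ENNReal.ofReal_le_ofReal
  rw [sum_nonempty_eq_add j, sum_nonempty_eq_add j, ← hDdef]
  set M : Finset (Fin n) := Finset.univ.erase j with hM
  have hMc : M.card = n - 1 := by simp [hM]
  have hjM {T : Finset (Fin n)} (hT : T ⊆ M) : j ∉ T := fun h => Finset.notMem_erase j _ (hT h)
  set G : Finset (Fin n) → ℝ := fun S =>
    (noisyProjectionLaw σ c v A (∑ i ∈ S, L i (X i))).real R with hG
  set G' : Finset (Fin n) → ℝ := fun S =>
    (noisyProjectionLaw σ c v A (∑ i ∈ S, L' i (X i))).real R with hG'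
  have hsum (T : Finset (Fin n)) (hT : T ⊆ M) : ∑ i ∈ T, L' i (X i) = ∑ i ∈ T, L i (X i) :=
    Finset.sum_congr rfl fun i hi => by rw [hj i fun e => hjM hT (e ▸ hi)]
  have hGG (T : Finset (Fin n)) (hT : T ⊆ M) : G' T = G T := by simp only [hG, hG', hsum T hT]
  have mech {μ μ' : Fin k → ℝ} (h : ∑ i, (μ i - μ' i) ^ 2 ≤ 2) :=
    noisyProjectionLaw_apply_le c v A hσ ε h hR
  have replace (T : Finset (Fin n)) (hT : T ⊆ M) :
      G (insert j T) ≤ Real.exp ε * G' (insert j T) + δ := by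
    refine mech ?_
    rw [Finset.sum_insert (hjM hT), Finset.sum_insert (hjM hT), hsum T hT]
    simpa using (hL j).sum_sq_sub_le (hL' j) (X j) (X j)
  have remove (T : Finset (Fin n)) (hT : T ⊆ M) :
      G (insert j T) ≤ Real.exp ε * G T + δ := by
    refine mech ?_
    rw [Finset.sum_insert (hjM hT)]
    simpa using (hL j).sum_sq_le (X j)
  have exchange (T : Finset (Fin n)) (hT : T ⊆ M) (i : Fin n) (hi : i ∉ T) :
      G (insert j T) ≤ Real.exp ε * G (insert i T) + δ := by
    refine mech ?_
    rw [Finset.sum_insert (hjM hT), Finset.sum_insert hi]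
    simpa using (hL j).sum_sq_sub_le (hL i) (X j) (X i)
  have hq : (0 : ℝ) ≤ 1 - p := by linarith
  have hB : ∑ T ∈ M.powerset with T.Nonempty, (p : ℝ) ^ T.card * (1 - p) ^ (n - 1 - T.card) * G' T =
      ∑ T ∈ M.powerset with T.Nonempty, (p : ℝ) ^ T.card * (1 - p) ^ (n - 1 - T.card) * G T :=
    Finset.sum_congr rfl fun T hT => by
      rw [hGG T (Finset.mem_powerset.1 (Finset.mem_filter.1 hT).1)]
  have f1 : ∑ T ∈ M.powerset, (p : ℝ) ^ T.card * (1 - p) ^ (n - 1 - T.card) * G (insert j T) ≤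
      Real.exp ε * ∑ T ∈ M.powerset,
        (p : ℝ) ^ T.card * (1 - p) ^ (n - 1 - T.card) * G' (insert j T) + δ := by
    have hw := sum_powerset_weights M (p : ℝ)
    rw [hMc] at hw
    calc _ ≤ ∑ T ∈ M.powerset, (p : ℝ) ^ T.card * (1 - p) ^ (n - 1 - T.card) *
          (Real.exp ε * G' (insert j T) + δ) := Finset.sum_le_sum fun T hT =>
            mul_le_mul_of_nonneg_left (replace T (Finset.mem_powerset.1 hT)) (by positivity)
      _ = _ := by
        simp_rw [mul_add]
        rw [Finset.sum_add_distrib, ← Finset.sum_mul, hw, one_mul, Finset.mul_sum]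
        congr 1
        exact Finset.sum_congr rfl fun T _ => by ring
  -- In the coupling, an unchanged set calls for removing `j`, and a set enlarged by `i` for
  -- exchanging `j` with `i`.
  have f2 := one_sub_mul_sum_powerset_le M hp0.le hp1.le (g := fun T => G (insert j T))
    (H := fun T => Real.exp ε * G T + δ) (fun T hT _ => remove T hT)
    (fun T hT i _ hi => exchange T hT i hi)
  have hw := sum_powerset_nonempty_weights M (p : ℝ)
  simp_rw [mul_add] at f2
  rw [Finset.sum_add_distrib, ← Finset.sum_mul, hw, hMc] at f2
  have f3 : ∑ T ∈ M.powerset with T.Nonempty,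
      (p : ℝ) ^ T.card * (1 - p) ^ (n - 1 - T.card) * (Real.exp ε * G T) =
      Real.exp ε * ∑ T ∈ M.powerset with T.Nonempty,
        (p : ℝ) ^ T.card * (1 - p) ^ (n - 1 - T.card) * G T := by
    rw [Finset.mul_sum]
    exact Finset.sum_congr rfl fun T _ => by ring
  rw [f3] at f2
  have f4 := mul_le_mul_of_nonneg_left f2 hq
  rw [← mul_assoc, ← hDp, mul_add, ← mul_assoc (1 - (p : ℝ)) (1 - _) δ, ← hDp] at f4
  have := amplification_le hp0 hpD (Real.one_le_exp_iff.2 (hε ▸ Real.log_nonneg (by linarith)))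
    hr f1 f4
  have := mul_le_mul_of_nonneg_left this (inv_pos.2 hD).le
  rw [hB]
  refine this.trans (le_of_eq ?_)
  rw [hδ', div_eq_mul_inv]
  ring
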